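/- Let $G$ be a totally disconnected, locally compact group and let $\alpha : G \to G$ be a continuous endomorphism. Write $\mathbb{N}=\{0,1,2,\dots\}$. For a compact open subgroup $U \le G$ and $n\in\mathbb{N}$ put $$U_+ = \{x\in U \mid \exists (x_k)_{k\in\mathbb{N}}\subseteq U \text{ with } x_0 = x \text{ and } \alpha(x_{k+1}) = x_k \text{ for all } k\},$$ $$U_{-n} = \bigcap_{k=0}^{n}\alpha^{-k}(U),\qquad U_- = \bigcap_{n\ge 0} U_{-n} = \{x\in U\mid \alpha^k(x)\in U \text{ for all } k\in\mathbb{N}\},$$ where $\alpha^{-k}(U)$ is the preimage of $U$ under $\alpha^k$. The compact open subgroup $U$ is called tidy for $\alpha$ if $U = U_+U_-$, the subgroup $U_{++} = \bigcup_{n\ge 0}\alpha^n(U_+)$ is closed in $G$, and the sequence of indices $[\alpha^{n+1}(U_+):\alpha^n(U_+)]$, $n\in\mathbb{N}$, is constant. Let $W$ be a compact open subgroup of $G$ that is tidy for $\alpha$. Then: 1. $W_{-n}$ is tidy for $\alpha$ for every $n\in\mathbb{N}$. 2. For every subgroup $V$ of $W_-$ that is open in $W_-$ (in the subspace topology) and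 contains $W_+\cap W_-$, there is an open subgroup $\hat W$ of $W$ that is tidy for $\alpha$, contains $W_+$, and satisfies $\hat W\cap W_-\le V$. 3. $$W_+\cap W_- = \bigcap\{\hat W \mid W_+\cap W_-\le \hat W\le W \text{ and } \hat W \text{ is tidy for } \alpha\}.$$ -/

import Mathlib

open scoped Pointwise

namespace TidyEndo

variable {G : Type*} [Group G] [TopologicalSpace G]

/-- A continuous endomorphism as an element of the monoid of endomorphisms under composition. -/
def toEnd (α : G →ₜ* G) : Monoid.End G := α.toMonoidHom

/-- The iterate `αⁿ` of a continuous endomorphism, as a group homomorphism. -/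
def iter (α : G →ₜ* G) (n : ℕ) : G →* G := toEnd α ^ n

theorem iter_apply (α : G →ₜ* G) (n : ℕ) (x : G) : iter α n x = α^[n] x :=
  congrFun (Monoid.End.coe_pow G (toEnd α) n) x

/-- `U₊`: the elements of `U` that have an `α`-regressive sequence lying in `U`. -/
def plus (α : G →ₜ* G) (U : Subgroup G) : Subgroup G where
  carrier := {x | x ∈ U ∧ ∃ s : ℕ → G, (∀ n, s n ∈ U) ∧ s 0 = x ∧ ∀ n, α (s (n + 1)) = s n}
  mul_mem' := by
    rintro x y ⟨hx, s, hs, hs0, hsα⟩ ⟨hy, t, ht, ht0, htα⟩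
    exact ⟨U.mul_mem hx hy, fun n => s n * t n, fun n => U.mul_mem (hs n) (ht n),
      by simp [hs0, ht0], fun n => by simp [hsα, htα]⟩
  one_mem' := ⟨U.one_mem, fun _ => 1, fun _ => U.one_mem, rfl, fun _ => map_one α⟩
  inv_mem' := by
    rintro x ⟨hx, s, hs, hs0, hsα⟩
    exact ⟨U.inv_mem hx, fun n => (s n)⁻¹, fun n => U.inv_mem (hs n),
      by simp [hs0], fun n => by simp [hsα]⟩

/-- `U₋ₙ = ⋂_{0 ≤ k ≤ n} α⁻ᵏ(U)`. -/
def minusN (α : G →ₜ* G) (U : Subgroup G) (n : ℕ) : Subgroup G :=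
  ⨅ k ∈ Set.Iic n, U.comap (iter α k)

/-- `U₋ = ⋂_{n ≥ 0} U₋ₙ`. -/
def minus (α : G →ₜ* G) (U : Subgroup G) : Subgroup G :=
  ⨅ n : ℕ, minusN α U n

theorem mem_minusN {α : G →ₜ* G} {U : Subgroup G} {n : ℕ} {x : G} :
    x ∈ minusN α U n ↔ ∀ k ≤ n, α^[k] x ∈ U := by
  simp [minusN, Subgroup.mem_iInf, iter_apply]

theorem mem_minus {α : G →ₜ* G} {U : Subgroup G} {x : G} :
    x ∈ minus α U ↔ ∀ n : ℕ, α^[n] x ∈ U := by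
  simp only [minus, Subgroup.mem_iInf, mem_minusN]
  exact ⟨fun h n => h n n le_rfl, fun h _ k _ => h k⟩

/-- `U₊₊ = ⋃_{n ≥ 0} αⁿ(U₊)`, as a subset of `G`. -/
def plusPlus (α : G →ₜ* G) (U : Subgroup G) : Set G :=
  ⋃ n : ℕ, ((plus α U).map (iter α n) : Set G)

/-- Condition TA: `U = U₊U₋`. -/
def IsTidyAbove (α : G →ₜ* G) (U : Subgroup G) : Prop :=
  (U : Set G) = (plus α U : Set G) * (minus α U : Set G)

/-- Conditions TB1 and TB2: `U₊₊` is closed, and the sequence of indices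
`[αⁿ⁺¹(U₊) : αⁿ(U₊)]` is constant. -/
def IsTidyBelow (α : G →ₜ* G) (U : Subgroup G) : Prop :=
  IsClosed (plusPlus α U) ∧
    ∃ c : ℕ, ∀ n : ℕ,
      ((plus α U).map (iter α n)).relIndex ((plus α U).map (iter α (n + 1))) = c

/-- `U` is a compact open subgroup that is tidy for `α`. -/
structure IsTidy (α : G →ₜ* G) (U : Subgroup G) : Prop where
  isCompact : IsCompact (U : Set G)
  isOpen : IsOpen (U : Set G)
  tidyAbove : IsTidyAbove α U
  tidyBelow : IsTidyBelow α U

end TidyEndo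

namespace TidyEndo

variable {G : Type*} [Group G] [TopologicalSpace G] {α : G →ₜ* G} {U W : Subgroup G}

/-! Passing from `U` to `U₋₁` keeps `U₋`, and `α` maps `(U₋₁)₊` onto `U₊`, so the tower of images
only shifts by one; claim 1 follows by induction.

For claim 2, `V₋` is the largest `α`-invariant subgroup of `V`, and it contains `W₊ ∩ W₋`. By
compactness `αⁿ(W₋)` eventually enters any open set around `W₊ ∩ W₋`, so finitely many conditions
cut `V₋` out of `W₋`, and `S = W₊V₋` is compact and open. Its stabilizer under left translation is
the required subgroup: it is open, lies in `S`, contains `W₊`, and meets `W₋` in an `α`-invariant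
subgroup.

For claim 3, claim 1 forces the intersection into `W₋`; there the closed subgroup `W₊ ∩ W₋` is cut
out by open subgroups, to which claim 2 applies. -/

theorem mem_plus {x : G} :
    x ∈ plus α U ↔ x ∈ U ∧ ∃ s : ℕ → G, (∀ n, s n ∈ U) ∧ s 0 = x ∧ ∀ n, α (s (n + 1)) = s n :=
  Iff.rfl

theorem plus_le : plus α U ≤ U := fun _ h => h.1

theorem minus_le : minus α U ≤ U := fun _ h => mem_minus.1 h 0

theorem mem_plus_of_regressive {s : ℕ → G} (hs : ∀ n, s n ∈ U) (hα : ∀ n, α (s (n + 1)) = s n)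
    (n : ℕ) : s n ∈ plus α U :=
  ⟨hs n, fun k => s (n + k), fun _ => hs _, rfl, fun k => hα (n + k)⟩

theorem exists_preimage_mem_plus {x : G} (hx : x ∈ plus α U) : ∃ y ∈ plus α U, α y = x := by
  obtain ⟨-, s, hs, rfl, hα⟩ := hx
  exact ⟨s 1, mem_plus_of_regressive hs hα 1, hα 0⟩

theorem map_mem_plus {x : G} (hx : x ∈ plus α U) (hU : α x ∈ U) : α x ∈ plus α U := by
  obtain ⟨-, s, hs, rfl, hα⟩ := hx
  refine ⟨hU, fun n => Nat.casesOn n (α (s 0)) s, ?_, rfl, ?_⟩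
  · rintro (_ | n)
    exacts [hU, hs n]
  · rintro (_ | n)
    exacts [rfl, hα n]

theorem map_mem_minus {x : G} (hx : x ∈ minus α U) : α x ∈ minus α U :=
  mem_minus.2 fun n => mem_minus.1 hx (n + 1)

theorem mem_minus_of_invariant {H : Subgroup G} (hHU : H ≤ U) (hH : ∀ x ∈ H, α x ∈ H) {x : G}
    (hx : x ∈ H) : x ∈ minus α U := by
  refine mem_minus.2 fun n => hHU ?_
  induction n with
  | zero => exact hx
  | succ n ih => rw [Function.iterate_succ_apply']; exact hH _ ih

theorem map_mem_plus_inf_minus {x : G} (hx : x ∈ plus α U ⊓ minus α U) :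
    α x ∈ plus α U ⊓ minus α U :=
  ⟨map_mem_plus hx.1 (minus_le (map_mem_minus hx.2)), map_mem_minus hx.2⟩

/-! ### Passage from `U` to `U₋₁` -/

theorem minusN_le (n : ℕ) : minusN α U n ≤ U := fun _ h => mem_minusN.1 h 0 n.zero_le

theorem minus_le_minusN (n : ℕ) : minus α U ≤ minusN α U n := iInf_le _ n

theorem minusN_zero : minusN α U 0 = U := by
  ext x; simp [mem_minusN]

theorem mem_minusN_one {x : G} : x ∈ minusN α U 1 ↔ x ∈ U ∧ α x ∈ U := by
  rw [mem_minusN]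
  constructor
  · exact fun h => ⟨h 0 zero_le_one, h 1 le_rfl⟩
  · rintro ⟨h0, h1⟩ k hk
    interval_cases k
    exacts [h0, h1]

theorem minusN_minusN_one (n : ℕ) : minusN α (minusN α U n) 1 = minusN α U (n + 1) := by
  ext x
  rw [mem_minusN_one]
  simp only [mem_minusN]
  constructor
  · rintro ⟨h0, h1⟩ (_ | k) hk
    exacts [h0 0 n.zero_le, h1 k (by omega)]
  · exact fun h => ⟨fun k hk => h k (by omega), fun k hk => h (k + 1) (by omega)⟩

theorem minus_minusN_one : minus α (minusN α U 1) = minus α U := by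
  ext x
  simp only [mem_minus, mem_minusN_one, ← Function.iterate_succ_apply' α]
  exact ⟨fun h n => (h n).1, fun h n => ⟨h n, h (n + 1)⟩⟩

theorem mem_plus_minusN_one {x : G} :
    x ∈ plus α (minusN α U 1) ↔ x ∈ plus α U ∧ α x ∈ plus α U := by
  constructor
  · rintro ⟨hx, s, hs, rfl, hα⟩
    have h : s 0 ∈ plus α U := mem_plus_of_regressive (fun n => minusN_le 1 (hs n)) hα 0
    exact ⟨h, map_mem_plus h (mem_minusN_one.1 hx).2⟩
  · rintro ⟨⟨hx, s, hs, rfl, hα⟩, h⟩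
    refine ⟨mem_minusN_one.2 ⟨hx, h.1⟩, s, fun n => mem_minusN_one.2 ⟨hs n, ?_⟩, rfl, hα⟩
    cases n with
    | zero => exact h.1
    | succ n => rw [hα]; exact hs n

theorem plus_minusN_one_le : plus α (minusN α U 1) ≤ plus α U :=
  fun _ h => (mem_plus_minusN_one.1 h).1

theorem map_iter_zero (H : Subgroup G) : H.map (iter α 0) = H := by
  ext x; simp [Subgroup.mem_map, iter_apply]

theorem map_iter_succ (H : Subgroup G) (n : ℕ) :
    H.map (iter α (n + 1)) = (H.map (α : G →* G)).map (iter α n) := by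
  ext x
  simp only [Subgroup.mem_map, iter_apply, exists_exists_and_eq_and, Function.iterate_succ_apply,
    MonoidHom.coe_coe]

theorem map_plus_minusN_one : (plus α (minusN α U 1)).map (α : G →* G) = plus α U := by
  ext x
  constructor
  · rintro ⟨y, hy, rfl⟩
    exact (mem_plus_minusN_one.1 hy).2
  · intro hx
    obtain ⟨y, hy, rfl⟩ := exists_preimage_mem_plus hx
    exact ⟨y, mem_plus_minusN_one.2 ⟨hy, hx⟩, rfl⟩

theorem map_iter_succ_plus_minusN_one (n : ℕ) :
    (plus α (minusN α U 1)).map (iter α (n + 1)) = (plus α U).map (iter α n) := by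
  rw [map_iter_succ, map_plus_minusN_one]

theorem plusPlus_minusN_one : plusPlus α (minusN α U 1) = plusPlus α U := by
  refine Set.Subset.antisymm (Set.iUnion_subset fun n => ?_) (Set.iUnion_subset fun n => ?_)
  · exact Set.subset_iUnion_of_subset n (Subgroup.map_mono plus_minusN_one_le)
  · rw [← map_iter_succ_plus_minusN_one]
    exact Set.subset_iUnion (fun k => ((plus α (minusN α U 1)).map (iter α k) : Set G)) (n + 1)

/-- `(U₋₁)₊ = U₊ ∩ α⁻¹(U₊)`, and indices pull back along `α`. -/
theorem relIndex_plus_minusN_one :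
    (plus α (minusN α U 1)).relIndex (plus α U) =
      (plus α U).relIndex ((plus α U).map (α : G →* G)) := by
  rw [← Subgroup.relIndex_comap, ← Subgroup.inf_relIndex_right ((plus α U).comap _)]
  congr 1
  ext x
  rw [mem_plus_minusN_one, Subgroup.mem_inf, Subgroup.mem_comap, and_comm]
  rfl

theorem IsTidyBelow.minusN_one (h : IsTidyBelow α U) : IsTidyBelow α (minusN α U 1) := by
  obtain ⟨hc, c, h⟩ := h
  refine ⟨by rwa [plusPlus_minusN_one], c, ?_⟩
  rintro (_ | n)
  -- The shift adds one index at the front; it equals the first index of `U`.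
  · have h0 := h 0
    rw [map_iter_zero, map_iter_succ, map_iter_zero] at h0
    rw [map_iter_succ_plus_minusN_one, map_iter_zero, map_iter_zero, relIndex_plus_minusN_one, h0]
  · rw [map_iter_succ_plus_minusN_one, map_iter_succ_plus_minusN_one]
    exact h n

theorem IsTidyAbove.exists_mul (h : IsTidyAbove α U) {x : G} (hx : x ∈ U) :
    ∃ y ∈ plus α U, ∃ z ∈ minus α U, y * z = x :=
  Set.mem_mul.1 (h.subset hx)

theorem isTidyAbove_iff :
    IsTidyAbove α U ↔ ∀ x ∈ U, ∃ y ∈ plus α U, ∃ z ∈ minus α U, y * z = x := by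
  refine ⟨fun h x hx => h.exists_mul hx, fun h => Set.Subset.antisymm h ?_⟩
  rintro _ ⟨y, hy, z, hz, rfl⟩
  exact U.mul_mem (plus_le hy) (minus_le hz)

theorem IsTidyAbove.minusN_one (h : IsTidyAbove α U) : IsTidyAbove α (minusN α U 1) := by
  refine isTidyAbove_iff.2 fun x hx => ?_
  rw [mem_minusN_one] at hx
  obtain ⟨y, hy, z, hz, rfl⟩ := h.exists_mul hx.1
  refine ⟨y, mem_plus_minusN_one.2 ⟨hy, map_mem_plus hy ?_⟩, z, by rwa [minus_minusN_one], rfl⟩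
  have h1 := hx.2
  rwa [map_mul, U.mul_mem_cancel_right (minus_le (map_mem_minus hz))] at h1

/-! ### Tidiness of subgroups containing `W₊` -/

theorem plus_eq_of_le (hU : U ≤ W) (hW : plus α W ≤ U) : plus α U = plus α W := by
  refine le_antisymm ?_ ?_
  · rintro _ ⟨-, s, hs, rfl, hα⟩
    exact mem_plus_of_regressive (fun n => hU (hs n)) hα 0
  · rintro _ ⟨hx, s, hs, rfl, hα⟩
    exact mem_plus_of_regressive (fun n => hW (mem_plus_of_regressive hs hα n)) hα 0

theorem IsTidyBelow.of_plus_eq (h : IsTidyBelow α W) (hU : plus α U = plus α W) :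
    IsTidyBelow α U := by
  unfold IsTidyBelow plusPlus
  rw [hU]
  exact h

/-- Factor `x = yz` in `W`. Since `W₊ ≤ U`, also `z ∈ U ∩ W₋`, which is `α`-invariant and so lies in
`U₋`. -/
theorem IsTidyAbove.of_plus_le (h : IsTidyAbove α W) (hU : U ≤ W) (hW : plus α W ≤ U)
    (hα : ∀ x ∈ U ⊓ minus α W, α x ∈ U) : IsTidyAbove α U := by
  refine isTidyAbove_iff.2 fun x hx => ?_
  obtain ⟨y, hy, z, hz, rfl⟩ := h.exists_mul (hU hx)
  have hzU : z ∈ U := (U.mul_mem_cancel_left (hW hy)).1 hx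
  exact ⟨y, by rwa [plus_eq_of_le hU hW], z, mem_minus_of_invariant (H := U ⊓ minus α W) inf_le_left
    (fun x hx => ⟨hα x hx, map_mem_minus hx.2⟩) ⟨hzU, hz⟩, rfl⟩

/-! ### Compactness -/

theorem isClosed_minus (hU : IsClosed (U : Set G)) : IsClosed (minus α U : Set G) := by
  have : (minus α U : Set G) = ⋂ n : ℕ, α^[n] ⁻¹' U := by
    ext x; simp [mem_minus]
  rw [this]
  exact isClosed_iInter fun n => hU.preimage (α.continuous_toFun.iterate n)

theorem isCompact_minus [T2Space G] (hU : IsCompact (U : Set G)) :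
    IsCompact (minus α U : Set G) :=
  hU.of_isClosed_subset (isClosed_minus hU.isClosed) minus_le

theorem isClosed_setOf_regressive [T2Space G] (k : ℕ) :
    IsClosed {s : ℕ → G | α (s (k + 1)) = s k} :=
  isClosed_eq (α.continuous_toFun.comp (continuous_apply _)) (continuous_apply _)

theorem isCompact_plus [T2Space G] (hU : IsCompact (U : Set G)) : IsCompact (plus α U : Set G) := by
  have : (plus α U : Set G) =
      (fun s : ℕ → G => s 0) ''
        ((Set.univ.pi fun _ => (U : Set G)) ∩ ⋂ k, {s : ℕ → G | α (s (k + 1)) = s k}) := by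
    ext x
    simp only [SetLike.mem_coe, mem_plus, Set.mem_image, Set.mem_inter_iff, Set.mem_univ_pi,
      Set.mem_iInter, Set.mem_ofPred_eq]
    constructor
    · rintro ⟨-, s, hs, h0, hα⟩
      exact ⟨s, ⟨hs, hα⟩, h0⟩
    · rintro ⟨s, ⟨hs, hα⟩, rfl⟩
      exact ⟨hs 0, s, hs, rfl, hα⟩
  rw [this]
  exact ((isCompact_univ_pi fun _ => hU).inter_right
    (isClosed_iInter isClosed_setOf_regressive)).image (continuous_apply 0)

theorem isCompact_minusN_one [T2Space G] (hU : IsCompact (U : Set G)) :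
    IsCompact (minusN α U 1 : Set G) := by
  have : (minusN α U 1 : Set G) = (U : Set G) ∩ α ⁻¹' (U : Set G) := by
    ext x; exact mem_minusN_one
  rw [this]
  exact hU.inter_right (hU.isClosed.preimage α.continuous_toFun)

theorem isOpen_minusN_one (hU : IsOpen (U : Set G)) : IsOpen (minusN α U 1 : Set G) := by
  have : (minusN α U 1 : Set G) = (U : Set G) ∩ α ⁻¹' (U : Set G) := by
    ext x; exact mem_minusN_one
  rw [this]
  exact hU.inter (hU.preimage α.continuous_toFun)

theorem IsTidy.minusN [T2Space G] (h : IsTidy α U) (n : ℕ) : IsTidy α (minusN α U n) := by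
  induction n with
  | zero => rwa [minusN_zero]
  | succ n ih =>
    rw [← minusN_minusN_one]
    exact ⟨isCompact_minusN_one ih.isCompact, isOpen_minusN_one ih.isOpen,
      ih.tidyAbove.minusN_one, ih.tidyBelow.minusN_one⟩

/-- The images `αⁿ(U₋)` are eventually contained in any open set around `U₊ ∩ U₋`. -/
theorem exists_iterate_mem_of_isOpen [T2Space G] (hU : IsCompact (U : Set G)) {O : Set G}
    (hO : IsOpen O) (h : (plus α U ⊓ minus α U : Set G) ⊆ O) :
    ∃ N : ℕ, ∀ n ≥ N, ∀ x ∈ minus α U, α^[n] x ∈ O := by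
  by_contra! hcon
  -- A point common to all `F n` is fully regressive in `U₋`, so its initial term is in `U₊ ∩ U₋`
  -- yet outside `O`.
  let F : ℕ → Set (ℕ → G) := fun n =>
    ((Set.univ.pi fun _ => (minus α U : Set G)) ∩ (fun s => s 0) ⁻¹' Oᶜ) ∩
      ⋂ k, ⋂ _ : k < n, {s : ℕ → G | α (s (k + 1)) = s k}
  have hcl : ∀ n, IsClosed (⋂ k, ⋂ _ : k < n, {s : ℕ → G | α (s (k + 1)) = s k}) := fun n =>
    isClosed_iInter fun k => isClosed_iInter fun _ => isClosed_setOf_regressive k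
  have hF : ∀ n, IsCompact (F n) := fun n =>
    ((isCompact_univ_pi fun _ => isCompact_minus hU).inter_right
      (hO.isClosed_compl.preimage (continuous_apply 0))).inter_right (hcl n)
  have hne : ∀ n, (F n).Nonempty := fun n => by
    obtain ⟨m, hm, x, hx, hxO⟩ := hcon n
    have hmem : ∀ k, α^[k] x ∈ minus α U := fun k => mem_minus.2 fun j => by
      rw [← Function.iterate_add_apply]; exact mem_minus.1 hx _
    -- The orbit of `x` read backwards from `αᵐ(x)`; truncated subtraction is harmless as `k < n ≤
    -- m`.
    refine ⟨fun k => α^[m - k] x, ⟨fun k _ => hmem _, hxO⟩, Set.mem_iInter₂.2 fun k hk => ?_⟩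
    change α (α^[m - (k + 1)] x) = α^[m - k] x
    rw [← Function.iterate_succ_apply' α]
    congr 2
    omega
  obtain ⟨s, hs⟩ := IsCompact.nonempty_iInter_of_sequence_nonempty_isCompact_isClosed F
    (fun n => Set.inter_subset_inter_right _ (Set.iInter_mono fun k =>
      Set.iInter_mono' fun hk => ⟨by omega, subset_rfl⟩)) hne (hF 0) fun n => (hF n).isClosed
  rw [Set.mem_iInter] at hs
  have hm : ∀ k, s k ∈ minus α U := fun k => (hs 0).1.1 k trivial
  have hα : ∀ k, α (s (k + 1)) = s k := fun k =>
    Set.mem_iInter₂.1 (hs (k + 1)).2 k (Nat.lt_succ_self k)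
  exact (hs 0).1.2 (h ⟨mem_plus_of_regressive (fun k => minus_le (hm k)) hα 0, hm 0⟩)

theorem plus_inf_minus_le_minus {V : Subgroup G} (h : plus α W ⊓ minus α W ≤ V) :
    plus α W ⊓ minus α W ≤ minus α V := fun _ hx =>
  mem_minus_of_invariant h (fun _ => map_mem_plus_inf_minus) hx

/-- The complement in `W₋` of the largest `α`-invariant subgroup of a relatively open `V` is
compact. -/
theorem isCompact_minus_diff [T2Space G] (hW : IsCompact (W : Set G)) {V : Subgroup G}
    (hVo : IsOpen (V.subgroupOf (minus α W) : Set (minus α W)))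
    (h : plus α W ⊓ minus α W ≤ V) :
    IsCompact ((minus α W : Set G) \ minus α V) := by
  obtain ⟨O, hO, hOV⟩ := isOpen_induced_iff.1 hVo
  have hmem : ∀ x ∈ minus α W, (x ∈ O ↔ x ∈ V) := fun x hx => Set.ext_iff.1 hOV ⟨x, hx⟩
  obtain ⟨N, hN⟩ := exists_iterate_mem_of_isOpen hW hO
    (fun x hx => (hmem x hx.2).2 (h hx))
  have hit : ∀ x ∈ minus α W, ∀ k, α^[k] x ∈ minus α W := fun x hx k => mem_minus.2 fun j => by
    rw [← Function.iterate_add_apply]; exact mem_minus.1 hx _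
  have heq : (minus α W : Set G) \ minus α V =
      (minus α W : Set G) ∩ ⋃ k ∈ Set.Iio N, α^[k] ⁻¹' Oᶜ := by
    ext x
    simp only [Set.mem_sdiff, Set.mem_inter_iff, SetLike.mem_coe, mem_minus (U := V),
      Set.mem_iUnion, Set.mem_preimage, Set.mem_compl_iff, Set.mem_Iio, not_forall, exists_prop]
    refine and_congr_right fun hx => ⟨?_, ?_⟩
    · rintro ⟨k, hk⟩
      rw [← hmem _ (hit x hx k)] at hk
      exact ⟨k, not_le.1 fun hkN => hk (hN k hkN x hx), hk⟩
    · rintro ⟨k, -, hk⟩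
      exact ⟨k, fun hkV => hk ((hmem _ (hit x hx k)).2 hkV)⟩
  rw [heq]
  exact (isCompact_minus hW).inter_right ((Set.finite_Iio N).isClosed_biUnion fun k _ =>
    hO.isClosed_compl.preimage (α.continuous_toFun.iterate k))

/-- Lift `w ∈ W₊` to `w₁ ∈ W₊`, write `x * w₁ = w' * y` and apply `α`: as `α y ∈ V₋`, the factor `α
w'` stays in `W`, hence in `W₊`. -/
theorem map_smul_plus_mul_minus_subset {V : Subgroup G} (hV : V ≤ minus α W) {x : G}
    (hx : x ∈ minus α W)
    (h : x • ((plus α W : Set G) * (minus α V : Set G)) ⊆ (plus α W : Set G) * (minus α V : Set G)) :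
    α x • ((plus α W : Set G) * (minus α V : Set G)) ⊆
      (plus α W : Set G) * (minus α V : Set G) := by
  rintro _ ⟨_, ⟨w, hw, v, hv, rfl⟩, rfl⟩
  obtain ⟨w₁, hw₁, rfl⟩ := exists_preimage_mem_plus hw
  obtain ⟨w', hw', y, hy, he⟩ := h ⟨w₁, ⟨w₁, hw₁, 1, one_mem _, mul_one _⟩, rfl⟩
  have he' : α w' * α y = α x * α w₁ := by
    rw [← map_mul, ← map_mul]; exact congrArg α he
  have hyW : α y ∈ W := minus_le (hV (minus_le (map_mem_minus hy)))
  have hwW : α w' ∈ W := by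
    rw [← W.mul_mem_cancel_right hyW, he']
    exact W.mul_mem (minus_le (map_mem_minus hx)) (plus_le hw)
  refine ⟨α w', map_mem_plus hw' hwW, α y * v, mul_mem (map_mem_minus hy) hv, ?_⟩
  simp only [smul_eq_mul, ← mul_assoc, he']

/-! ### The stabilizer of `W₊V₋` -/

variable [IsTopologicalGroup G]

theorem isOpen_plus_mul_minus [T2Space G] (hW : IsTidy α W) {V : Subgroup G}
    (hV : V ≤ minus α W) (hVo : IsOpen (V.subgroupOf (minus α W) : Set (minus α W)))
    (h : plus α W ⊓ minus α W ≤ V) :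
    IsOpen ((plus α W : Set G) * (minus α V : Set G)) := by
  have hle : minus α V ≤ minus α W := minus_le.trans hV
  have heq : (plus α W : Set G) * (minus α V : Set G) =
      (W : Set G) \ ((plus α W : Set G) * ((minus α W : Set G) \ minus α V)) := by
    ext x
    constructor
    · rintro ⟨w, hw, v, hv, rfl⟩
      refine ⟨W.mul_mem (plus_le hw) (minus_le (hle hv)), ?_⟩
      rintro ⟨w', hw', v', ⟨hv', hv'V⟩, he⟩
      have he' : w'⁻¹ * w = v' * v⁻¹ := by
        rw [eq_mul_inv_iff_mul_eq, mul_assoc, inv_mul_eq_iff_eq_mul]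
        exact he.symm
      -- Two factorizations differ by an element of `W₊ ∩ W₋ ≤ V₋`, so membership of the second
      -- factor in `V₋` is well defined.
      have hmem : w'⁻¹ * w ∈ plus α W ⊓ minus α W :=
        ⟨(plus α W).mul_mem ((plus α W).inv_mem hw') hw,
          he' ▸ (minus α W).mul_mem hv' ((minus α W).inv_mem (hle hv))⟩
      have := (minus α V).mul_mem (plus_inf_minus_le_minus h hmem) hv
      rw [he', inv_mul_cancel_right] at this
      exact hv'V this
    · rintro ⟨hx, hn⟩
      obtain ⟨w, hw, v, hv, rfl⟩ := hW.tidyAbove.exists_mul hx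
      by_cases hvV : v ∈ minus α V
      · exact ⟨w, hw, v, hvV, rfl⟩
      · exact absurd ⟨w, hw, v, ⟨hv, hvV⟩, rfl⟩ hn
  rw [heq]
  exact hW.isOpen.sdiff
    ((isCompact_plus hW.isCompact).mul (isCompact_minus_diff hW.isCompact hVo h)).isClosed

theorem isOpen_stabilizer {S : Set G} (hS : IsCompact S) (hSo : IsOpen S) :
    IsOpen (MulAction.stabilizer G S : Set G) := by
  obtain ⟨N, hN, hNS⟩ := compact_open_separated_mul_left hS hSo subset_rfl
  -- Intersecting `N` with its inverse gives `x • S ⊆ S` and `x⁻¹ • S ⊆ S` together.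
  refine Subgroup.isOpen_of_mem_nhds _ (g := 1) (Filter.mem_of_superset
    (Filter.inter_mem hN (inv_mem_nhds_one G hN)) ?_)
  rintro x ⟨hx, hx'⟩
  refine MulAction.mem_stabilizer_iff.2 (Set.Subset.antisymm ?_ ?_)
  · exact (Set.smul_set_subset_mul hx).trans hNS
  · rw [Set.subset_smul_set_iff]
    exact (Set.smul_set_subset_mul (Set.mem_inv.1 hx')).trans hNS

theorem IsTidy.exists_isTidy_inf_minus_le [T2Space G] (hW : IsTidy α W) {V : Subgroup G}
    (hV : V ≤ minus α W) (hVo : IsOpen (V.subgroupOf (minus α W) : Set (minus α W)))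
    (h : plus α W ⊓ minus α W ≤ V) :
    ∃ W' : Subgroup G, W' ≤ W ∧ IsOpen (W' : Set G) ∧ IsTidy α W' ∧
      plus α W ≤ W' ∧ W' ⊓ minus α W ≤ V := by
  have hle : minus α V ≤ minus α W := minus_le.trans hV
  let S : Set G := (plus α W : Set G) * (minus α V : Set G)
  have hSo : IsOpen S := isOpen_plus_mul_minus hW hV hVo h
  have hVc : IsCompact (minus α V : Set G) := by
    refine (isCompact_minus hW.isCompact).of_isClosed_subset (isClosed_minus ?_) hle
    have hcl := Subgroup.isClosed_of_isOpen (V.subgroupOf (minus α W)) hVo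
    have := (isClosed_minus (α := α) hW.isCompact.isClosed).isClosedMap_subtype_val _ hcl
    rwa [← Subgroup.coe_subtype, ← Subgroup.coe_map, Subgroup.map_subgroupOf_eq_of_le hV] at this
  have hSc : IsCompact S := (isCompact_plus hW.isCompact).mul hVc
  have hSW : S ⊆ W := by
    rintro _ ⟨w, hw, v, hv, rfl⟩
    exact W.mul_mem (plus_le hw) (minus_le (hle hv))
  let W' : Subgroup G := MulAction.stabilizer G S
  have hW'o : IsOpen (W' : Set G) := isOpen_stabilizer hSc hSo
  have hW'S : (W' : Set G) ⊆ S := fun x hx => by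
    rw [← MulAction.mem_stabilizer_iff.1 hx]
    exact ⟨1, ⟨1, one_mem _, 1, one_mem _, mul_one 1⟩, mul_one x⟩
  have hW'W : W' ≤ W := fun x hx => hSW (hW'S hx)
  have hplus : plus α W ≤ W' := fun x hx => by
    refine MulAction.mem_stabilizer_iff.2 ?_
    rw [← smul_mul_assoc, smul_coe_set hx]
  have hinv : ∀ x ∈ W' ⊓ minus α W, α x ∈ W' := fun x hx => by
    have hx1 := MulAction.mem_stabilizer_iff.1 hx.1
    have hx2 := MulAction.mem_stabilizer_iff.1 (inv_mem hx.1)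
    refine MulAction.mem_stabilizer_iff.2 (Set.Subset.antisymm ?_ ?_)
    · exact map_smul_plus_mul_minus_subset hV hx.2 hx1.subset
    · rw [Set.subset_smul_set_iff, ← map_inv]
      exact map_smul_plus_mul_minus_subset hV (inv_mem hx.2) hx2.subset
  refine ⟨W', hW'W, hW'o, ⟨?_, hW'o, hW.tidyAbove.of_plus_le hW'W hplus hinv,
    hW.tidyBelow.of_plus_eq (plus_eq_of_le hW'W hplus)⟩, hplus, ?_⟩
  · exact hW.isCompact.of_isClosed_subset (Subgroup.isClosed_of_isOpen _ hW'o) hW'W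
  · rintro x ⟨hx, hxm⟩
    obtain ⟨w, hw, v, hv, rfl⟩ := hW'S hx
    have hwm : w ∈ minus α W := ((minus α W).mul_mem_cancel_right (hle hv)).1 hxm
    exact V.mul_mem (h ⟨hw, hwm⟩) (minus_le hv)

/-- In a compact totally disconnected group, points outside a closed subgroup are separated from it
by an open subgroup. -/
theorem exists_isOpen_subgroup_notMem {H : Type*} [Group H] [TopologicalSpace H]
    [IsTopologicalGroup H] [CompactSpace H] [TotallyDisconnectedSpace H] (K : Subgroup H)
    (hK : IsClosed (K : Set H)) {x : H} (hx : x ∉ K) :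
    ∃ V : Subgroup H, IsOpen (V : Set H) ∧ K ≤ V ∧ x ∉ V := by
  -- An open normal subgroup `N` inside this set satisfies `x ∉ KN`.
  have hO : IsOpen ((fun n : H => x * n⁻¹) ⁻¹' (K : Set H)ᶜ) :=
    hK.isOpen_compl.preimage (by fun_prop)
  obtain ⟨N, hN⟩ := ProfiniteGrp.exist_openNormalSubgroup_sub_open_nhds_of_one hO (by simpa using hx)
  refine ⟨K ⊔ N.toSubgroup, Subgroup.isOpen_mono le_sup_right N.isOpen', le_sup_left, fun hxV => ?_⟩
  obtain ⟨k, hk, n, hn, rfl⟩ := Subgroup.mem_sup_of_normal_right.1 hxV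
  exact hN hn (by simpa using hk)

theorem IsTidy.plus_inf_minus_eq_sInf [T2Space G] [TotallyDisconnectedSpace G] (hW : IsTidy α W) :
    plus α W ⊓ minus α W =
      sInf {W' : Subgroup G | plus α W ⊓ minus α W ≤ W' ∧ W' ≤ W ∧ IsTidy α W'} := by
  refine le_antisymm (le_sInf fun W' h => h.1) fun x hx => ?_
  rw [Subgroup.mem_sInf] at hx
  have hxm : x ∈ minus α W := by
    refine (Subgroup.mem_iInf).2 fun n => hx _ ⟨?_, minusN_le n, hW.minusN n⟩
    exact inf_le_right.trans (minus_le_minusN n)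
  by_contra hxn
  have := isCompact_iff_compactSpace.1 (isCompact_minus (α := α) hW.isCompact)
  have : CompactSpace (minus α W) := this
  obtain ⟨V, hVo, hKV, hxV⟩ := exists_isOpen_subgroup_notMem
    ((plus α W).subgroupOf (minus α W))
    ((isCompact_plus hW.isCompact).isClosed.preimage continuous_subtype_val)
    (x := ⟨x, hxm⟩) (fun h => hxn ⟨h, hxm⟩)
  have hsub : (V.map (minus α W).subtype).subgroupOf (minus α W) = V :=
    Subgroup.comap_map_eq_self_of_injective (Subgroup.subtype_injective _) V
  obtain ⟨W', hW'W, -, hW', hplus, hW'V⟩ := hW.exists_isTidy_inf_minus_le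
    (V := V.map (minus α W).subtype) (Subgroup.map_subtype_le V) (hsub.symm ▸ hVo)
    (fun y hy => ⟨⟨y, hy.2⟩, hKV hy.1, rfl⟩)
  obtain ⟨⟨y, hy⟩, hyV, rfl⟩ :=
    hW'V ⟨hx W' ⟨inf_le_left.trans hplus, hW'W, hW'⟩, hxm⟩
  exact hxV hyV

end TidyEndo

theorem mainTheorem10 {G : Type*} [Group G] [TopologicalSpace G] [IsTopologicalGroup G]
    [LocallyCompactSpace G] [TotallyDisconnectedSpace G]
    (α : G →ₜ* G) (W : Subgroup G) (hW : TidyEndo.IsTidy α W) :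
    (∀ n : ℕ, TidyEndo.IsTidy α (TidyEndo.minusN α W n)) ∧
    (∀ V : Subgroup G, V ≤ TidyEndo.minus α W →
      IsOpen (V.subgroupOf (TidyEndo.minus α W) : Set (TidyEndo.minus α W)) →
      TidyEndo.plus α W ⊓ TidyEndo.minus α W ≤ V →
      ∃ W' : Subgroup G, W' ≤ W ∧ IsOpen (W' : Set G) ∧ TidyEndo.IsTidy α W' ∧
        TidyEndo.plus α W ≤ W' ∧ W' ⊓ TidyEndo.minus α W ≤ V) ∧
    TidyEndo.plus α W ⊓ TidyEndo.minus α W =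
      sInf {W' : Subgroup G | TidyEndo.plus α W ⊓ TidyEndo.minus α W ≤ W' ∧ W' ≤ W ∧
        TidyEndo.IsTidy α W'} := by
  exact ⟨hW.minusN, fun _ hV hVo h => hW.exists_isTidy_inf_minus_le hV hVo h,
    hW.plus_inf_minus_eq_sInf⟩
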